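/- Let $X$ be an infinite-dimensional complex Hausdorff topological vector space and let $T:X\to X$ be a continuous linear operator. Let $X^*$ be the space of continuous linear functionals on $X$, let $T^*:X^*\to X^*$ be the dual operator $(T^*f)(x)=f(Tx)$, and let $\sigma_p(T^*)$ be the set of eigenvalues of $T^*$. Write $\mathbb{R}_+=[0,\infty)$ and $\mathbb{T}=\{z\in\mathbb{C}:|z|=1\}$. The operator $T$ is called supercyclic if there is $x\in X$ such that $\{sT^nx : s\in\mathbb{C},\ n\ge 0\}$ is dense in $X$, and $\mathbb{R}_+$-supercyclic if there is $x\in X$ such that $\{sT^nx : s\in\mathbb{R}_+,\ n\ge 0\}$ is dense in $X$. Then $T$ is $\mathbb{R}_+$-supercyclic if and only if $T$ is supercyclic and either $\sigma_p(T^*)=\varnothing$ or $\sigma_p(T^*)=\{z\}$ for some $z\in\mathbb{C}\setminus\{0\}$ such that $z/|z|$ has infinite order in the group $\mathbb{T}$. -/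

import Mathlib

open scoped NNReal

namespace Supercyclicity

/-- An element `x` is universal for a family `F` of maps `X → Y` if its orbit `{F a x : a}` is
dense in `Y`. -/
def IsUniversalElement {A X Y : Type*} [TopologicalSpace Y] (F : A → X → Y) (x : X) : Prop :=
  Dense (Set.range fun a => F a x)

/-- A family of maps is universal if it has a universal element. -/
def IsUniversalFamily {A X Y : Type*} [TopologicalSpace Y] (F : A → X → Y) : Prop :=
  ∃ x : X, IsUniversalElement F x

section Operator

variable {X : Type*} [AddCommGroup X] [Module ℂ X] [TopologicalSpace X]

/-- The family `{s Tⁿ : s ∈ ℂ, n ≥ 0}`. -/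
def scaledPowers (T : X →L[ℂ] X) : ℂ × ℕ → X → X :=
  fun p x => p.1 • (T ^ p.2) x

/-- The family `{s Tⁿ : s ∈ ℝ₊, n ≥ 0}`, where `ℝ₊` is the set of nonnegative reals. -/
def nonnegScaledPowers (T : X →L[ℂ] X) : ℝ≥0 × ℕ → X → X :=
  fun p x => ((p.1 : ℝ) : ℂ) • (T ^ p.2) x

/-- `T` is supercyclic if the family of all complex multiples of its powers is universal. -/
def IsSupercyclic (T : X →L[ℂ] X) : Prop :=
  IsUniversalFamily (scaledPowers T)

/-- `T` is `ℝ₊`-supercyclic if the family of all nonnegative multiples of its powers is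
universal. -/
def IsRPlusSupercyclic (T : X →L[ℂ] X) : Prop :=
  IsUniversalFamily (nonnegScaledPowers T)

/-- The dual operator `T* : X* → X*`, `(T* f)(x) = f (T x)`, on the space of continuous linear
functionals. -/
noncomputable def dualOperator (T : X →L[ℂ] X) : Module.End ℂ (X →L[ℂ] ℂ) where
  toFun f := f.comp T
  map_add' _ _ := rfl
  map_smul' _ _ := rfl

/-- The point spectrum `σ_p(T*)` of the dual operator: the set of its eigenvalues. -/
def dualPointSpectrum (T : X →L[ℂ] X) : Set ℂ :=
  {z : ℂ | (dualOperator T).HasEigenvalue z}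

end Operator

/-- The element `z / |z|` of the circle group, for a nonzero complex number `z`. -/
noncomputable def phase (z : ℂ) (hz : z ≠ 0) : Circle :=
  ⟨z / (‖z‖ : ℂ), mem_sphere_zero_iff_norm.2 (by simp [hz])⟩

end Supercyclicity

/-!
Throughout, `O(x)` denotes `orbitClosure T x`, the closure of `{s Tⁿ x : s ≥ 0, n ≥ 0}`.

*Necessity.* Along the scaled orbit of a supercyclic vector the ratio of two eigenfunctionals of
`T*` behaves like a geometric sequence, so its size is bounded on one side; by density the kernel of
one functional lies in the kernel of the other, and the eigenvalues agree
(`IsSupercyclicVector.dualPointSpectrum_subsingleton`). An eigenfunctional for `z` maps the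
`ℝ₊`-scaled orbit to the rays through the `zⁿ`, and these are dense only if `z ≠ 0` and `z / |z|`
has infinite order (`IsRPlusSupercyclic.ne_zero_and_not_isOfFinOrder`).

*Sufficiency.* For a supercyclic vector `x`, compactness of the circle shows that every vector `y`
can be rotated into `O(x)`. The unimodular `c` with `c x ∈ O(x)` form a closed submonoid of the
circle. If it is the whole circle, then `O(x) = X`. Otherwise it has a finite
exponent `k`, and the `k`-th power of the rotation that takes `y` into `O(x)` is a continuous
`T`-invariant function of the supercyclic vector `y`, homogeneous of degree `-k` under rotation
(`exists_phase_function`). Such a function is excluded topologically. There are many supercyclic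
vectors, because `p(T)` has dense range as soon as no root of `p` lies in `σ_p(T*)`
(`IsSupercyclicVector.map_aeval`):

* if `σ_p(T*) = ∅`, the circle through `x` contracts within the supercyclic vectors, which
  contradicts the nonzero degree `-k`;
* if `σ_p(T*) = {z}`, the supercyclic vectors contain a convex set on which `z⁻¹ T` acts with a
  dense orbit. The logarithm of the phase function on this set grows by a nonzero constant under the
  action, so it has discrete values on a dense set; but it is continuous on a connected set.

Continuous logarithms on contractible spaces come from the homotopy lifting property of the covering
`Circle.exp` (`exists_continuous_exp_eq`).
-/

namespace Supercyclicity

open Set Topology Polynomial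

/-! ### Continuous logarithms of circle-valued functions -/

/-- A continuous map from a contractible space to the circle has a continuous logarithm: lift a
contraction of the space through the covering `Circle.exp`. No local path-connectedness is needed,
so this applies to convex sets in topological vector spaces that are not locally convex. -/
theorem exists_continuous_exp_eq {A : Type*} [TopologicalSpace A] [ContractibleSpace A]
    {ψ : A → Circle} (hψ : Continuous ψ) :
    ∃ g : A → ℝ, Continuous g ∧ ∀ a, Circle.exp (g a) = ψ a := by
  obtain ⟨a₀, ⟨H⟩⟩ := id_nullhomotopic A
  obtain ⟨t₀, ht₀⟩ := Circle.exp_surjective (ψ a₀)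
  let G : C(unitInterval × A, Circle) := (⟨ψ, hψ⟩ : C(A, Circle)).comp H.symm.toContinuousMap
  have hG : ∀ a, G (0, a) = Circle.exp ((ContinuousMap.const A t₀) a) := fun a ↦ by
    simp [G, ht₀]
  refine ⟨fun a ↦ Circle.isCoveringMap_exp.liftHomotopy G _ hG (1, a), by fun_prop, fun a ↦ ?_⟩
  have := congrFun (Circle.isCoveringMap_exp.liftHomotopy_lifts G _ hG) (1, a)
  simpa [G] using this

/-- A continuous function on a connected space with values in `a + ℤ c` is constant. -/
theorem eq_of_forall_exists_int {A : Type*} [TopologicalSpace A] [PreconnectedSpace A]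
    {g : A → ℝ} (hg : Continuous g) {a c : ℝ} (h : ∀ y, ∃ n : ℤ, g y = a + n * c) (y y' : A) :
    g y = g y' := by
  rcases eq_or_ne c 0 with rfl | hc
  · obtain ⟨n, hn⟩ := h y
    obtain ⟨m, hm⟩ := h y'
    simp [hn, hm]
  have hT : IsDiscrete (range ((↑) : ℤ → ℝ)) :=
    Int.isClosedEmbedding_coe_real.isEmbedding.isDiscrete_range
  have := (isPreconnected_univ (α := A)).constant_of_mapsTo hT
    (f := fun y ↦ (g y - a) / c) (by fun_prop) (fun y _ ↦ by
      obtain ⟨n, hn⟩ := h y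
      exact ⟨n, by simp [hn, hc]⟩) (mem_univ y) (mem_univ y')
  field_simp at this
  linarith

/-- If the exponentials of two continuous functions on a connected space differ by a constant
factor, then the functions differ by a constant. -/
theorem sub_eq_sub_of_exp_eq {A : Type*} [TopologicalSpace A] [PreconnectedSpace A]
    {g₁ g₂ : A → ℝ} (h₁ : Continuous g₁) (h₂ : Continuous g₂) {w : Circle}
    (h : ∀ y, Circle.exp (g₁ y) = w * Circle.exp (g₂ y)) (y y' : A) :
    g₁ y - g₂ y = g₁ y' - g₂ y' := by
  obtain ⟨t, rfl⟩ := Circle.exp_surjective w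
  refine eq_of_forall_exists_int (h₁.sub h₂) (a := t) (c := 2 * Real.pi) (fun z ↦ ?_) y y'
  obtain ⟨m, hm⟩ := Circle.exp_eq_exp.1 ((h z).trans (Circle.exp_add _ _).symm)
  exact ⟨m, by rw [Pi.sub_apply, hm]; ring⟩

/-! ### Closed submonoids of the circle -/

/-- A proper closed submonoid of the circle has finite exponent. By compactness it is closed under
inverses, and the corresponding subgroup of `ℝ` is not dense, hence cyclic. -/
theorem exists_pow_eq_one_of_isClosed {M : Submonoid Circle} (hM : IsClosed (M : Set Circle))
    (hne : M ≠ ⊤) : ∃ k : ℕ, k ≠ 0 ∧ ∀ g ∈ M, g ^ k = 1 := by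
  set S := Subgroup.closure (M : Set Circle) with hS
  have hSM : (S : Set Circle) ⊆ M := by
    have := closure_submonoidClosure_eq_closure_subgroupClosure (M : Set Circle)
    rw [Submonoid.closure_eq, hM.closure_eq] at this
    rw [this]
    exact subset_closure
  let A : AddSubgroup ℝ :=
    { carrier := {t | Circle.exp t ∈ S}
      zero_mem' := by simp
      add_mem' := fun {a b} ha hb ↦ by
        simpa only [mem_ofPred_eq, Circle.exp_add] using S.mul_mem ha hb
      neg_mem' := fun {a} ha ↦ by
        simpa only [mem_ofPred_eq, Circle.exp_neg] using S.inv_mem ha }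
  rcases A.dense_or_cyclic with hd | ⟨a, ha⟩
  · refine absurd (SetLike.coe_injective ?_) hne
    have h₁ := (Circle.exp_surjective.denseRange.dense_image Circle.exp.continuous hd).mono
      (image_subset_iff.2 (show (A : Set ℝ) ⊆ Circle.exp ⁻¹' M from fun t ht ↦ hSM ht))
    rw [← hM.closure_eq, h₁.closure_eq]
    rfl
  · have hmem : ∀ t, Circle.exp t ∈ S → ∃ n : ℤ, n • a = t := fun t ht ↦
      AddSubgroup.mem_closure_singleton.1 (ha ▸ (show t ∈ A from ht))
    obtain ⟨m, hm⟩ := hmem (2 * Real.pi) (by simp)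
    have hm0 : m ≠ 0 := by
      rintro rfl
      simp [Real.pi_ne_zero] at hm
    refine ⟨m.natAbs, by simpa using hm0, fun g hg ↦ ?_⟩
    obtain ⟨t, rfl⟩ := Circle.exp_surjective g
    obtain ⟨n, rfl⟩ := hmem t (Subgroup.subset_closure hg)
    have h1 : Circle.exp (n • a) ^ m = 1 := by
      rw [← Circle.exp_zsmul, smul_comm, hm, Circle.exp_zsmul, Circle.exp_two_pi, one_zpow]
    rcases Int.natAbs_eq m with h | h
    · rw [h] at h1
      simpa only [zpow_natCast] using h1
    · rw [h] at h1
      simpa only [zpow_neg, zpow_natCast, inv_eq_one] using h1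

/-! ### Supercyclic vectors and eigenfunctionals -/

variable {X : Type*} [AddCommGroup X] [Module ℂ X] [TopologicalSpace X]

/-- A vector `x` is supercyclic for `T` if its complex multiples `s Tⁿ x` are dense. -/
abbrev IsSupercyclicVector (T : X →L[ℂ] X) (x : X) : Prop :=
  IsUniversalElement (scaledPowers T) x

/-- An operator with dense range that commutes with `T` maps supercyclic vectors for `T` to
supercyclic vectors for `T`. -/
theorem IsSupercyclicVector.map {T S : X →L[ℂ] X} {x : X} (hx : IsSupercyclicVector T x)
    (hS : DenseRange S) (hc : Commute S T) : IsSupercyclicVector T (S x) := by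
  have := hS.dense_image S.continuous hx
  refine this.mono ?_
  rintro _ ⟨_, ⟨⟨s, n⟩, rfl⟩, rfl⟩
  refine ⟨(s, n), ?_⟩
  simp only [scaledPowers, map_smul]
  rw [← mul_apply_eq_comp, ← mul_apply_eq_comp, (hc.pow_right n).eq]

theorem IsSupercyclicVector.smul {T : X →L[ℂ] X} {x : X} (hx : IsSupercyclicVector T x)
    {c : ℂ} (hc : c ≠ 0) : IsSupercyclicVector T (c • x) := by
  refine hx.mono ?_
  rintro _ ⟨⟨s, n⟩, rfl⟩
  exact ⟨(s * c⁻¹, n), by simp [scaledPowers, smul_smul, hc]⟩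

theorem IsUniversalElement.isSupercyclicVector {T : X →L[ℂ] X} {x : X}
    (hx : IsUniversalElement (nonnegScaledPowers T) x) : IsSupercyclicVector T x := by
  refine hx.mono ?_
  rintro _ ⟨⟨s, n⟩, rfl⟩
  exact ⟨(((s : ℝ) : ℂ), n), rfl⟩

theorem IsRPlusSupercyclic.isSupercyclic {T : X →L[ℂ] X} (hT : IsRPlusSupercyclic T) :
    IsSupercyclic T :=
  let ⟨x, hx⟩ := hT
  ⟨x, hx.isSupercyclicVector⟩

theorem mem_dualPointSpectrum_iff {T : X →L[ℂ] X} {z : ℂ} :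
    z ∈ dualPointSpectrum T ↔ ∃ f : X →L[ℂ] ℂ, f ≠ 0 ∧ ∀ x, f (T x) = z * f x := by
  refine ⟨fun h ↦ ?_, fun ⟨f, hf, hz⟩ ↦
    Module.End.hasEigenvalue_of_hasEigenvector
      ⟨Module.End.mem_eigenspace_iff.2 (ContinuousLinearMap.ext hz), hf⟩⟩
  obtain ⟨f, hf⟩ := Module.End.HasEigenvalue.exists_hasEigenvector h
  exact ⟨f, hf.2, fun x ↦ DFunLike.congr_fun hf.apply_eq_smul x⟩

theorem eigenfunctional_pow {T : X →L[ℂ] X} {f : X →L[ℂ] ℂ} {z : ℂ}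
    (hf : ∀ x, f (T x) = z * f x) (n : ℕ) (x : X) : f ((T ^ n) x) = z ^ n * f x := by
  induction n with
  | zero => simp
  | succ n ih => rw [pow_succ', mul_apply_eq_comp, hf, ih, pow_succ', mul_assoc]

theorem IsSupercyclicVector.eigenfunctional_ne_zero {T : X →L[ℂ] X} {x : X}
    (hx : IsSupercyclicVector T x) {f : X →L[ℂ] ℂ} {z : ℂ} (hf : ∀ x, f (T x) = z * f x)
    (h0 : f ≠ 0) : f x ≠ 0 := by
  refine fun hfx ↦ h0 (DFunLike.coe_injective (Continuous.ext_on hx f.continuous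
    (0 : X →L[ℂ] ℂ).continuous ?_))
  rintro _ ⟨⟨s, n⟩, rfl⟩
  change f (s • (T ^ n) x) = 0
  rw [map_smul, eigenfunctional_pow hf, hfx, mul_zero, smul_zero]

/-! ### Constraints on the point spectrum of the dual operator -/

/-- If `f₁`, `f₂` are eigenfunctionals with eigenvalues `|z₁| ≤ |z₂|`, then
`|f₁ y| |f₂ x| ≤ |f₂ y| |f₁ x|` for `y` in the scaled orbit of `x`, hence for all `y`. So
`f₂ y = 0` implies `f₁ y = 0`, and `y = T u - z₂ u` gives `z₁ = z₂`. -/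
theorem IsSupercyclicVector.dualPointSpectrum_subsingleton {T : X →L[ℂ] X} {x : X}
    (hx : IsSupercyclicVector T x) : (dualPointSpectrum T).Subsingleton := by
  have main : ∀ z₁ ∈ dualPointSpectrum T, ∀ z₂ ∈ dualPointSpectrum T, ‖z₁‖ ≤ ‖z₂‖ → z₁ = z₂ := by
    intro z₁ h₁ z₂ h₂ hle
    obtain ⟨f₁, hne₁, hf₁⟩ := mem_dualPointSpectrum_iff.1 h₁
    obtain ⟨f₂, hne₂, hf₂⟩ := mem_dualPointSpectrum_iff.1 h₂
    have hx₂ := hx.eigenfunctional_ne_zero hf₂ hne₂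
    have hbound : ∀ y, ‖f₁ y‖ * ‖f₂ x‖ ≤ ‖f₂ y‖ * ‖f₁ x‖ := by
      have hcl : IsClosed {y | ‖f₁ y‖ * ‖f₂ x‖ ≤ ‖f₂ y‖ * ‖f₁ x‖} :=
        isClosed_le (by fun_prop) (by fun_prop)
      refine fun y ↦ closure_minimal ?_ hcl (hx y)
      rintro _ ⟨⟨s, n⟩, rfl⟩
      simp only [mem_ofPred_eq, scaledPowers, map_smul, eigenfunctional_pow hf₁,
        eigenfunctional_pow hf₂, norm_smul, norm_mul, norm_pow]
      have : ‖z₁‖ ^ n ≤ ‖z₂‖ ^ n := by gcongr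
      calc _ = (‖s‖ * ‖f₁ x‖ * ‖f₂ x‖) * ‖z₁‖ ^ n := by ring
        _ ≤ (‖s‖ * ‖f₁ x‖ * ‖f₂ x‖) * ‖z₂‖ ^ n := by gcongr
        _ = _ := by ring
    obtain ⟨u, hu⟩ : ∃ u, f₁ u ≠ 0 := by
      by_contra! h
      exact hne₁ (ContinuousLinearMap.ext h)
    have h0 : f₁ (T u - z₂ • u) = 0 := by
      have := hbound (T u - z₂ • u)
      rw [show f₂ (T u - z₂ • u) = 0 by simp [hf₂], norm_zero, zero_mul] at this
      by_contra hne
      have := mul_pos (norm_pos_iff.2 hne) (norm_pos_iff.2 hx₂)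
      linarith
    rw [map_sub, map_smul, hf₁, smul_eq_mul, sub_eq_zero] at h0
    exact mul_right_cancel₀ hu h0
  intro z₁ h₁ z₂ h₂
  rcases le_total ‖z₁‖ ‖z₂‖ with h | h
  · exact main _ h₁ _ h₂ h
  · exact (main _ h₂ _ h₁ h).symm

/-- If `zᵐ = |z|ᵐ` for some `m ≥ 1`, then an eigenfunctional for `z`, normalized at an
`ℝ₊`-supercyclic vector, takes only values `v` with `vᵐ ≥ 0`, which is impossible for a nonzero
functional. The case `z = 0` is covered by `m = 1`. -/
theorem IsRPlusSupercyclic.ne_zero_and_not_isOfFinOrder {T : X →L[ℂ] X}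
    (hT : IsRPlusSupercyclic T) {z : ℂ} (hz : z ∈ dualPointSpectrum T) :
    ∃ h0 : z ≠ 0, ¬ IsOfFinOrder (phase z h0) := by
  obtain ⟨x, hx⟩ := hT
  obtain ⟨f, hne, hf⟩ := mem_dualPointSpectrum_iff.1 hz
  have hfx : f x ≠ 0 :=
    hx.isSupercyclicVector.eigenfunctional_ne_zero hf hne
  have H : ∀ m : ℕ, m ≠ 0 → z ^ m ≠ (‖z‖ : ℂ) ^ m := by
    intro m hm hzm
    have hcl : IsClosed {y | (f y / f x) ^ m = (‖f y / f x‖ : ℂ) ^ m} :=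
      isClosed_eq (by fun_prop) (by fun_prop)
    have hall : ∀ y, (f y / f x) ^ m = (‖f y / f x‖ : ℂ) ^ m := fun y ↦ by
      refine closure_minimal ?_ hcl (hx y)
      rintro _ ⟨⟨s, n⟩, rfl⟩
      have hquot : f (((s : ℝ) : ℂ) • (T ^ n) x) / f x = ((s : ℝ) : ℂ) * z ^ n := by
        rw [map_smul, eigenfunctional_pow hf, smul_eq_mul, ← mul_assoc, mul_div_assoc,
          div_self hfx, mul_one]
      change (f (((s : ℝ) : ℂ) • (T ^ n) x) / f x) ^ m =
        (‖f (((s : ℝ) : ℂ) • (T ^ n) x) / f x‖ : ℂ) ^ m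
      rw [hquot, norm_mul, norm_pow, Complex.norm_real, Real.norm_of_nonneg s.coe_nonneg,
        Complex.ofReal_mul, Complex.ofReal_pow, mul_pow, mul_pow, pow_right_comm,
        hzm, pow_right_comm]
    obtain ⟨c, hc⟩ := IsAlgClosed.exists_pow_nat_eq (-1 : ℂ) (Nat.pos_of_ne_zero hm)
    have := hall (c • x)
    rw [map_smul, smul_eq_mul, mul_div_assoc, div_self hfx, mul_one, ← Complex.ofReal_pow,
      ← norm_pow, hc] at this
    norm_num at this
  have h0 : z ≠ 0 := by
    rintro rfl
    exact H 1 one_ne_zero (by simp)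
  refine ⟨h0, fun hfin ↦ ?_⟩
  obtain ⟨m, hm, hpow⟩ := isOfFinOrder_iff_pow_eq_one.1 hfin
  refine H m hm.ne' ?_
  have h1 : (z / (‖z‖ : ℂ)) ^ m = 1 := congrArg (fun c : Circle ↦ (c : ℂ)) hpow
  rwa [div_pow, div_eq_one_iff_eq (by simp [h0])] at h1

/-! ### Closures of orbits up to nonnegative multiples -/

/-- The closure of the set of nonnegative real multiples `s Tⁿ x` of the orbit of `x`. -/
def orbitClosure (T : X →L[ℂ] X) (x : X) : Set X :=
  closure (range fun p ↦ nonnegScaledPowers T p x)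

theorem smul_pow_mem_orbitClosure_self (T : X →L[ℂ] X) (x : X) {r : ℝ} (hr : 0 ≤ r) (n : ℕ) :
    (r : ℂ) • (T ^ n) x ∈ orbitClosure T x :=
  subset_closure ⟨(⟨r, hr⟩, n), rfl⟩

theorem mem_orbitClosure_self (T : X →L[ℂ] X) (x : X) : x ∈ orbitClosure T x := by
  simpa using smul_pow_mem_orbitClosure_self T x zero_le_one 0

theorem isClosed_orbitClosure (T : X →L[ℂ] X) (x : X) : IsClosed (orbitClosure T x) :=
  isClosed_closure

variable [ContinuousSMul ℂ X]

theorem smul_pow_mem_orbitClosure {T : X →L[ℂ] X} {x y : X} (hy : y ∈ orbitClosure T x)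
    {r : ℝ} (hr : 0 ≤ r) (n : ℕ) : (r : ℂ) • (T ^ n) y ∈ orbitClosure T x := by
  refine map_mem_closure (f := fun y ↦ (r : ℂ) • (T ^ n) y) (by fun_prop) hy ?_
  rintro _ ⟨⟨s, m⟩, rfl⟩
  refine ⟨(⟨r, hr⟩ * s, n + m), ?_⟩
  change ((r * s : ℝ) : ℂ) • (T ^ (n + m)) x = (r : ℂ) • (T ^ n) ((s : ℂ) • (T ^ m) x)
  rw [map_smul, smul_smul, pow_add, Complex.ofReal_mul, mul_apply_eq_comp]

theorem orbitClosure_subset {T : X →L[ℂ] X} {x y : X} (hy : y ∈ orbitClosure T x) :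
    orbitClosure T y ⊆ orbitClosure T x := by
  refine closure_minimal ?_ (isClosed_orbitClosure T x)
  rintro _ ⟨⟨s, m⟩, rfl⟩
  exact smul_pow_mem_orbitClosure hy s.2 m

theorem smul_mem_orbitClosure_smul {T : X →L[ℂ] X} {x y : X} (hy : y ∈ orbitClosure T x) (c : ℂ) :
    c • y ∈ orbitClosure T (c • x) := by
  refine map_mem_closure (f := fun y ↦ c • y) (by fun_prop) hy ?_
  rintro _ ⟨⟨s, m⟩, rfl⟩
  exact ⟨(s, m), by simp only [nonnegScaledPowers, map_smul, smul_comm c]⟩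

/-- The cocycle property of the sets `{a : a • y ∈ orbitClosure T x}`. For `x = y = z` it makes
the unimodular elements of such a set a submonoid of the circle. -/
theorem smul_mem_orbitClosure_trans {T : X →L[ℂ] X} {x y z : X} {a b : ℂ}
    (hy : a • y ∈ orbitClosure T x) (hz : b • z ∈ orbitClosure T y) :
    (a * b) • z ∈ orbitClosure T x := by
  rw [mul_smul]
  exact orbitClosure_subset hy (smul_mem_orbitClosure_smul hz a)

/-- By compactness of the circle, rotating `orbitClosure T x` by a closed set of angles gives a
closed set. -/
theorem isClosed_setOf_exists_smul_mem_orbitClosure (T : X →L[ℂ] X) (x : X) {K : Set Circle}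
    (hK : IsClosed K) : IsClosed {y : X | ∃ c ∈ K, (c : ℂ) • y ∈ orbitClosure T x} := by
  have h : IsClosed {p : Circle × X | p.1 ∈ K ∧ (p.1 : ℂ) • p.2 ∈ orbitClosure T x} :=
    (hK.preimage continuous_fst).inter
      ((isClosed_orbitClosure T x).preimage (by fun_prop))
  convert isClosedMap_snd_of_compactSpace _ h
  ext y
  simp

/-- If `x` is supercyclic, then every vector lies in `orbitClosure T x` after a rotation. -/
theorem IsSupercyclicVector.exists_smul_mem {T : X →L[ℂ] X} {x : X} (hx : IsSupercyclicVector T x)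
    (y : X) : ∃ c : Circle, (c : ℂ) • y ∈ orbitClosure T x := by
  have hcl := isClosed_setOf_exists_smul_mem_orbitClosure T x isClosed_univ
  have hsub : range (fun p ↦ scaledPowers T p x) ⊆
      {y : X | ∃ c ∈ (univ : Set Circle), (c : ℂ) • y ∈ orbitClosure T x} := by
    rintro _ ⟨⟨s, n⟩, rfl⟩
    obtain ⟨c, hc⟩ : ∃ c : Circle, (c : ℂ) * s = (‖s‖ : ℂ) := by
      rcases eq_or_ne s 0 with rfl | hs
      · exact ⟨1, by simp⟩
      · refine ⟨(phase s hs)⁻¹, ?_⟩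
        rw [Circle.coe_inv]
        change (s / (‖s‖ : ℂ))⁻¹ * s = _
        field_simp
    refine ⟨c, mem_univ _, ?_⟩
    simp only [scaledPowers, smul_smul, hc]
    exact smul_pow_mem_orbitClosure_self T x (norm_nonneg s) n
  have : y ∈ closure (range fun p ↦ scaledPowers T p x) := hx y
  obtain ⟨c, -, hc⟩ := closure_minimal hsub hcl this
  exact ⟨c, hc⟩

/-- If `T` is supercyclic but not `ℝ₊`-supercyclic, then the rotation that brings a supercyclic
vector `y` into `orbitClosure T x` is unique up to a factor of finite order `k`, so that its `k`-th
power is a well-defined continuous function of `y`. It is invariant under `T` and under positive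
scaling, and homogeneous of degree `-k` under rotation. Values at vectors that are not supercyclic
are arbitrary. -/
theorem exists_phase_function {T : X →L[ℂ] X} {x : X} (hx : IsSupercyclicVector T x)
    (hT : DenseRange T) (hR : ¬ IsRPlusSupercyclic T) :
    ∃ (k : ℕ) (h : X → Circle), k ≠ 0 ∧ ContinuousOn h {y | IsSupercyclicVector T y} ∧
      (∀ y, IsSupercyclicVector T y → h (T y) = h y) ∧
      (∀ y, IsSupercyclicVector T y → ∀ c : Circle, h ((c : ℂ) • y) = (c ^ k)⁻¹ * h y) ∧
      (∀ y, IsSupercyclicVector T y → ∀ r : ℝ, 0 < r → h ((r : ℂ) • y) = h y) := by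
  let M : Submonoid Circle :=
    { carrier := {c | (c : ℂ) • x ∈ orbitClosure T x}
      one_mem' := by simpa using mem_orbitClosure_self T x
      mul_mem' := fun {a b} ha hb ↦ by
        simpa only [mem_ofPred_eq, Circle.coe_mul] using smul_mem_orbitClosure_trans ha hb }
  have hM : IsClosed (M : Set Circle) :=
    (isClosed_orbitClosure T x).preimage (f := fun c : Circle ↦ (c : ℂ) • x) (by fun_prop)
  have hne : M ≠ ⊤ := by
    refine fun hM ↦ hR ⟨x, fun y ↦ ?_⟩
    obtain ⟨c, hc⟩ := hx.exists_smul_mem y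
    -- `y = c⁻¹ (c y)` with `c y ∈ O(x)`, and `c⁻¹ x ∈ O(x)`
    have h1 : c⁻¹ ∈ M := hM ▸ Submonoid.mem_top _
    change y ∈ orbitClosure T x
    have := orbitClosure_subset h1 (smul_mem_orbitClosure_smul hc (c⁻¹ : Circle))
    simpa [smul_smul] using this
  obtain ⟨k, hk, hpow⟩ := exists_pow_eq_one_of_isClosed hM hne
  choose c hc using hx.exists_smul_mem
  have key : ∀ y, IsSupercyclicVector T y → ∀ a : Circle, (a : ℂ) • y ∈ orbitClosure T x →
      c y ^ k = a ^ k := by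
    intro y hy a ha
    -- `c y` and `a` become elements of `M` when multiplied by a rotation taking `x` into `O(y)`
    obtain ⟨b, hb⟩ := hy.exists_smul_mem x
    have h1 := hpow (c y * b) (by
      change ((c y * b : Circle) : ℂ) • x ∈ orbitClosure T x
      rw [Circle.coe_mul]
      exact smul_mem_orbitClosure_trans (hc y) hb)
    have h2 := hpow (a * b) (by
      change ((a * b : Circle) : ℂ) • x ∈ orbitClosure T x
      rw [Circle.coe_mul]
      exact smul_mem_orbitClosure_trans ha hb)
    rw [mul_pow] at h1 h2
    exact mul_right_cancel (h1.trans h2.symm)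
  refine ⟨k, fun y ↦ c y ^ k, hk, ?_, fun y hy ↦ ?_, fun y hy a ↦ ?_, fun y hy r hr ↦ ?_⟩
  · rw [continuousOn_iff_isClosed]
    intro K hK
    refine ⟨_, isClosed_setOf_exists_smul_mem_orbitClosure T x (hK.preimage (continuous_pow k)), ?_⟩
    ext y
    refine and_congr_left fun hy ↦ ⟨fun h ↦ ⟨c y, h, hc y⟩, ?_⟩
    rintro ⟨a, ha, hay⟩
    simpa only [mem_preimage, key y hy a hay] using ha
  · refine key _ (hy.map hT (Commute.refl T)) _ ?_
    simpa using smul_pow_mem_orbitClosure (hc y) zero_le_one 1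
  · have := key _ (hy.smul a.coe_ne_zero) (c y * a⁻¹) (by simpa [smul_smul] using hc y)
    rwa [mul_pow, mul_comm, inv_pow] at this
  · refine key _ (hy.smul (by exact_mod_cast hr.ne')) _ ?_
    rw [smul_comm]
    simpa using smul_pow_mem_orbitClosure (hc y) hr.le 0

variable [IsTopologicalAddGroup X]

/-! ### Polynomials in a supercyclic operator -/

/-- If the closure `L` of the range of `T - c` is not everything, then `T` acts on the quotient by
`L` as the scalar `c`. The image of a supercyclic vector spans a dense, hence full, subspace of the
quotient, so the quotient is finite-dimensional and its functionals are continuous; pulled back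
to `X`, they are eigenfunctionals. Local convexity of `X` plays no role. -/
theorem IsSupercyclicVector.denseRange_sub {T : X →L[ℂ] X} {x : X}
    (hx : IsSupercyclicVector T x) {c : ℂ} (hc : c ∉ dualPointSpectrum T) :
    DenseRange (T - c • (1 : X →L[ℂ] X)) := by
  let L : Submodule ℂ X :=
    (LinearMap.range (T - c • (1 : X →L[ℂ] X)).toLinearMap).topologicalClosure
  have hmem : ∀ y, T y - c • y ∈ L := fun y ↦
    Submodule.le_topologicalClosure _ ⟨y, by simp⟩
  have hLc : IsClosed (L : Set X) := Submodule.isClosed_topologicalClosure _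
  by_contra hdense
  have hLtop : L ≠ ⊤ := fun h ↦ hdense (Submodule.dense_iff_topologicalClosure_eq_top.2 h)
  have hquot : ∀ y, L.mkQL (T y) = c • L.mkQL y := fun y ↦ by
    rw [← map_smul]
    exact (Submodule.Quotient.eq L).2 (hmem y)
  have hpow : ∀ n, L.mkQL ((T ^ n) x) = c ^ n • L.mkQL x := fun n ↦ by
    induction n with
    | zero => simp
    | succ n ih => rw [pow_succ', mul_apply_eq_comp, hquot, ih, smul_smul, pow_succ']
  have hspan : (Submodule.span ℂ {L.mkQL x} : Submodule ℂ (X ⧸ L)) = ⊤ := by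
    rw [eq_top_iff]
    rintro q -
    have hcl : IsClosed ((Submodule.span ℂ {L.mkQL x} : Submodule ℂ (X ⧸ L)) : Set (X ⧸ L)) :=
      Submodule.closed_of_finiteDimensional _
    obtain ⟨y, rfl⟩ := L.mkQ_surjective q
    refine closure_minimal ?_ (hcl.preimage L.mkQL.continuous) (hx y)
    rintro _ ⟨⟨s, n⟩, rfl⟩
    refine Submodule.mem_span_singleton.2 ⟨s * c ^ n, ?_⟩
    rw [mul_smul, ← hpow, ← map_smul]
    rfl
  have hfd : FiniteDimensional ℂ (X ⧸ L) := .of_fg_top (hspan ▸ ⟨{L.mkQL x}, by simp⟩)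
  obtain ⟨y, hy⟩ : ∃ y, y ∉ L := by
    by_contra! h
    exact hLtop (eq_top_iff.2 fun y _ ↦ h y)
  have hy' : L.mkQ y ≠ 0 := by simpa using hy
  obtain ⟨φ, hφ⟩ : ∃ φ : Module.Dual ℂ (X ⧸ L), φ (L.mkQ y) ≠ 0 := by
    by_contra! h
    exact hy' ((Module.forall_dual_apply_eq_zero_iff ℂ _).1 h)
  refine hc (mem_dualPointSpectrum_iff.2
    ⟨(LinearMap.toContinuousLinearMap φ).comp L.mkQL, fun h ↦ hφ ?_, fun u ↦ ?_⟩)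
  · exact DFunLike.congr_fun h y
  · simp only [ContinuousLinearMap.comp_apply, hquot, map_smul, smul_eq_mul]

theorem IsSupercyclicVector.map_aeval {T : X →L[ℂ] X} {x : X} (hx : IsSupercyclicVector T x)
    {p : ℂ[X]} (hp : p ≠ 0) (hroot : ∀ c ∈ p.roots, c ∉ dualPointSpectrum T) :
    IsSupercyclicVector T (aeval T p x) := by
  have hcomm : ∀ q : ℂ[X], Commute (aeval T q) T := fun q ↦ by
    simpa only [aeval_X] using (Commute.all q Polynomial.X).map (aeval T)
  have hprod : ∀ s : Multiset ℂ, (∀ c ∈ s, c ∉ dualPointSpectrum T) →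
      IsSupercyclicVector T (aeval T (s.map fun c ↦ Polynomial.X - C c).prod x) := by
    intro s
    induction s using Multiset.induction_on with
    | empty => simpa using hx
    | cons c s ih =>
      intro hs
      rw [Multiset.map_cons, Multiset.prod_cons, map_mul, mul_apply_eq_comp]
      refine (ih fun c hc ↦ hs c (Multiset.mem_cons_of_mem hc)).map ?_ (hcomm _)
      have := hx.denseRange_sub (hs c (Multiset.mem_cons_self c s))
      rwa [map_sub, aeval_X, aeval_C, Algebra.algebraMap_eq_smul_one]
  rw [(IsAlgClosed.splits p).eq_prod_roots, map_mul, aeval_C, mul_apply_eq_comp,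
    Algebra.algebraMap_eq_smul_one]
  exact (hprod _ hroot).smul (leadingCoeff_ne_zero.2 hp)

theorem eigenfunctional_aeval {T : X →L[ℂ] X} {f : X →L[ℂ] ℂ} {z : ℂ}
    (hf : ∀ x, f (T x) = z * f x) (p : ℂ[X]) (x : X) :
    f (aeval T p x) = p.eval z * f x := by
  induction p using Polynomial.induction_on' with
  | add p q hp hq => simp only [map_add, add_apply, hp, hq, eval_add, add_mul]
  | monomial n a =>
    rw [aeval_monomial, Algebra.algebraMap_eq_smul_one, smul_one_mul,
      smul_apply, map_smul, eigenfunctional_pow hf, eval_monomial, smul_eq_mul,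
      mul_assoc]

/-! ### From supercyclicity to `ℝ₊`-supercyclicity -/

/-- When `σ_p(T*) = ∅`, the cone over the loop `t ↦ e^{it} x` with apex `T x` consists of
supercyclic vectors, while the phase function winds `-k ≠ 0` times along the loop. -/
theorem isRPlusSupercyclic_of_dualPointSpectrum_eq_empty {T : X →L[ℂ] X}
    (hT : IsSupercyclic T) (hempty : dualPointSpectrum T = ∅) : IsRPlusSupercyclic T := by
  obtain ⟨x, hx⟩ := hT
  have hroot : ∀ c, c ∉ dualPointSpectrum T := by simp [hempty]
  by_contra hR
  have hdense : DenseRange T := by simpa using IsSupercyclicVector.denseRange_sub hx (hroot 0)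
  obtain ⟨k, h, hk, hcont, -, hrot, -⟩ := exists_phase_function hx hdense hR
  let γ : ℝ × ℝ → X := fun p ↦ ((1 - p.1) * Circle.exp p.2 : ℂ) • x + (p.1 : ℂ) • T x
  have hγ : ∀ p, IsSupercyclicVector T (γ p) := by
    intro p
    have hne : C ((1 - p.1) * Circle.exp p.2 : ℂ) + C (p.1 : ℂ) * Polynomial.X ≠ 0 := by
      intro h0
      have h1 := congrArg (eval 0) h0
      have h2 := congrArg (eval 1) h0
      simp only [eval_add, eval_C, eval_mul, eval_X, eval_zero, mul_zero, add_zero, mul_one]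
        at h1 h2
      rw [h1, zero_add] at h2
      simp [h2] at h1
    convert IsSupercyclicVector.map_aeval hx hne fun c _ ↦ hroot c
    simp only [γ, map_add, map_mul (aeval T), aeval_C, aeval_X, Algebra.algebraMap_eq_smul_one,
      smul_one_mul, add_apply, smul_apply, one_apply_eq_self]
  obtain ⟨g, hg, hexp⟩ := exists_continuous_exp_eq
    (hcont.comp_continuous (f := γ) (by fun_prop) hγ)
  -- The winding number of `t ↦ g (s, t)` is the same for `s = 0` and `s = 1`; it vanishes for
  -- `s = 1`, where `γ` is constant, and equals `-k` for `s = 0`.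
  have hside := sub_eq_sub_of_exp_eq (g₁ := fun s : ℝ ↦ g (s, 2 * Real.pi))
    (g₂ := fun s ↦ g (s, 0)) (w := 1) (by fun_prop) (by fun_prop)
    (fun s ↦ by simp [hexp, γ]) 0 1
  have hright := sub_eq_sub_of_exp_eq (g₁ := fun t : ℝ ↦ g (1, t)) (g₂ := fun _ ↦ 0)
    (w := h (T x)) (by fun_prop) (by fun_prop) (fun t ↦ by simp [hexp, γ]) (2 * Real.pi) 0
  have hleft := sub_eq_sub_of_exp_eq (g₁ := fun t : ℝ ↦ g (0, t)) (g₂ := fun t ↦ -(k * t))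
    (w := h x) (by fun_prop) (by fun_prop) (fun t ↦ by
      have hγt : γ (0, t) = (Circle.exp t : ℂ) • x := by simp [γ]
      rw [hexp, Function.comp_apply, hγt, hrot x hx, Circle.exp_neg, mul_comm,
        ← nsmul_eq_mul, Circle.exp_nsmul])
    (2 * Real.pi) 0
  simp only [mul_zero, neg_zero, sub_zero] at hright hleft hside
  have : (k : ℝ) * (2 * Real.pi) = 0 := by linarith
  simp [hk, Real.pi_ne_zero] at this

/-- When `σ_p(T*) = {z}` with eigenfunctional `f`, the vectors `p(T) x` with `p(z) = 1` form a
convex set `K` of supercyclic vectors in the hyperplane `f = f x`. It is invariant under `S = z⁻¹ T`, and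
`x` has dense `S`-orbit in `K`. The phase function is multiplied by `(z / |z|)ᵏ ≠ 1` under `S`, so
its continuous logarithm `g` on `K` satisfies `g ∘ S = g + c` with `c ≠ 0`. Hence `g` takes values
in `g x + ℤ c` on a dense set, thus everywhere, and is constant: a contradiction. -/
theorem isRPlusSupercyclic_of_dualPointSpectrum_eq_singleton {T : X →L[ℂ] X}
    (hT : IsSupercyclic T) {z : ℂ} (hz : z ≠ 0) (hsing : dualPointSpectrum T = {z})
    (hord : ¬ IsOfFinOrder (phase z hz)) : IsRPlusSupercyclic T := by
  obtain ⟨x, hx⟩ := hT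
  by_contra hR
  have hdense : DenseRange T := by
    simpa using IsSupercyclicVector.denseRange_sub hx (c := 0) (by simpa [hsing] using hz.symm)
  obtain ⟨k, h, hk, hcont, hinv, hrot, hpos⟩ := exists_phase_function hx hdense hR
  obtain ⟨f, hne, hf⟩ := mem_dualPointSpectrum_iff.1 (hsing ▸ mem_singleton z)
  have hfx : f x ≠ 0 := IsSupercyclicVector.eigenfunctional_ne_zero hx hf hne
  let K : Set X := {y | ∃ p : ℂ[X], p.eval z = 1 ∧ aeval T p x = y}
  have hK : ∀ y ∈ K, IsSupercyclicVector T y := by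
    rintro _ ⟨p, hp, rfl⟩
    have hp0 : p ≠ 0 := by
      rintro rfl
      simp at hp
    refine IsSupercyclicVector.map_aeval hx hp0 fun c hc hcz ↦ ?_
    rw [hsing, mem_singleton_iff] at hcz
    rw [mem_roots hp0, IsRoot.def, hcz, hp] at hc
    exact one_ne_zero hc
  have hfK : ∀ y ∈ K, f y = f x := by
    rintro _ ⟨p, hp, rfl⟩
    rw [eigenfunctional_aeval hf, hp, one_mul]
  have hxK : x ∈ K := ⟨1, by simp, by simp⟩
  have hconv : Convex ℝ K := by
    rintro _ ⟨p, hp, rfl⟩ _ ⟨q, hq, rfl⟩ a b - - hab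
    refine ⟨C (a : ℂ) * p + C (b : ℂ) * q, ?_, ?_⟩
    · simp only [eval_add, eval_mul, eval_C, hp, hq, mul_one]
      exact_mod_cast hab
    · simp only [map_add, map_mul, aeval_C, Algebra.algebraMap_eq_smul_one, smul_one_mul,
        add_apply, smul_apply]
      simp only [Complex.coe_smul]
  have : ContinuousSMul ℝ X := IsScalarTower.continuousSMul ℂ
  have : ContractibleSpace K := hconv.contractibleSpace ⟨x, hxK⟩
  let S : K → K := fun y ↦ ⟨z⁻¹ • T y, by
    obtain ⟨_, p, hp, rfl⟩ := y
    refine ⟨C z⁻¹ * (Polynomial.X * p), by simp [hp, hz], ?_⟩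
    simp only [map_mul, aeval_C, aeval_X, Algebra.algebraMap_eq_smul_one, smul_one_mul,
      smul_apply, mul_apply_eq_comp]⟩
  have hS : Continuous S := by fun_prop
  let ψ : K → Circle := fun y ↦ h y
  have hψ : Continuous ψ := hcont.comp_continuous continuous_subtype_val fun y ↦ hK y y.2
  have hψS : ∀ y, ψ (S y) = phase z hz ^ k * ψ y := by
    intro y
    have hTy : IsSupercyclicVector T (T y) := (hK y y.2).map hdense (Commute.refl T)
    -- `z⁻¹` is a positive scaling composed with the rotation by the inverse of `z / |z|`
    have hzinv : z⁻¹ = ((‖z‖⁻¹ : ℝ) : ℂ) * ((phase z hz)⁻¹ : Circle) := by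
      rw [Circle.coe_inv]
      change z⁻¹ = ((‖z‖⁻¹ : ℝ) : ℂ) * (z / (‖z‖ : ℂ))⁻¹
      have : (‖z‖ : ℂ) ≠ 0 := by simpa using hz
      push_cast
      field_simp
    change h (z⁻¹ • T y) = _ * h y
    rw [hzinv, mul_smul, hpos _ (hTy.smul (Circle.coe_ne_zero _)) _ (by simpa using hz),
      hrot _ hTy, hinv _ (hK y y.2), inv_pow, inv_inv]
  obtain ⟨g, hg, hexp⟩ := exists_continuous_exp_eq hψ
  let x₀ : K := ⟨x, hxK⟩
  have hstep : ∀ y, g (S y) = g y + (g (S x₀) - g x₀) := fun y ↦ by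
    have := sub_eq_sub_of_exp_eq (hg.comp hS) hg (w := phase z hz ^ k)
      (fun y ↦ by simp only [Function.comp_apply, hexp, hψS]) y x₀
    simp only [Function.comp_apply] at this
    linarith
  set c := g (S x₀) - g x₀ with hc
  have hc0 : c ≠ 0 := by
    intro h0
    have h1 : ψ (S x₀) = ψ x₀ := by rw [← hexp, ← hexp, sub_eq_zero.1 (hc.symm.trans h0)]
    rw [hψS, mul_eq_right] at h1
    exact hord (isOfFinOrder_iff_pow_eq_one.2 ⟨k, Nat.pos_of_ne_zero hk, h1⟩)
  have hiter : ∀ n, g (S^[n] x₀) = g x₀ + n * c := fun n ↦ by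
    induction n with
    | zero => simp
    | succ n ih =>
      rw [Function.iterate_succ_apply', hstep, ih]
      push_cast
      ring
  have hSiter : ∀ n, ((S^[n] x₀ : K) : X) = (z ^ n)⁻¹ • (T ^ n) x := fun n ↦ by
    induction n with
    | zero => simp [x₀]
    | succ n ih =>
      rw [Function.iterate_succ_apply']
      change z⁻¹ • T (S^[n] x₀ : K) = _
      rw [ih, map_smul, smul_smul, pow_succ' T, mul_apply_eq_comp, pow_succ', mul_inv]
  have horbit : DenseRange fun n ↦ S^[n] x₀ := by
    intro y
    have hfy : f y ≠ 0 := hfK y y.2 ▸ hfx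
    -- Normalizing `s Tⁿ x` so that `f` takes the value `f x` turns it into `Sⁿ x`, and this
    -- normalization is continuous near `y`, which is already normalized.
    have hy : (y : X) ∈ closure ({u | f u ≠ 0} ∩ range fun p ↦ scaledPowers T p x) :=
      (isOpen_ne_fun f.continuous continuous_const).inter_closure ⟨hfy, hx y⟩
    have hcontAt : ContinuousAt (fun u ↦ (f x / f u) • u) (y : X) :=
      (continuousAt_const.div f.continuous.continuousAt hfy).smul continuousAt_id
    rw [closure_subtype]
    have := hcontAt.continuousWithinAt.mem_closure hy
      (t := Subtype.val '' range fun n ↦ S^[n] x₀) ?_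
    · simpa [hfK y y.2, hfx] using this
    · rintro _ ⟨hu, ⟨s, n⟩, rfl⟩
      refine ⟨_, ⟨n, rfl⟩, ?_⟩
      change f (s • (T ^ n) x) ≠ 0 at hu
      change _ = (f x / f (s • (T ^ n) x)) • s • (T ^ n) x
      rw [hSiter, smul_smul]
      rw [map_smul, eigenfunctional_pow hf, smul_eq_mul] at hu ⊢
      have hs : s ≠ 0 := left_ne_zero_of_mul hu
      congr 1
      field_simp
  have hint : ∀ y, ∃ n : ℤ, g y = g x₀ + n * c := by
    have hcl : IsClosed {y | (g y - g x₀) / c ∈ range ((↑) : ℤ → ℝ)} :=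
      Int.isClosedEmbedding_coe_real.isClosed_range.preimage (by fun_prop)
    intro y
    have hsub : (range fun n ↦ S^[n] x₀) ⊆ {y | (g y - g x₀) / c ∈ range ((↑) : ℤ → ℝ)} := by
      rintro _ ⟨n, rfl⟩
      exact ⟨n, by simp [hiter, hc0]⟩
    obtain ⟨n, hn⟩ := closure_minimal hsub hcl (horbit y)
    refine ⟨n, ?_⟩
    field_simp at hn
    linarith
  exact hc0 (sub_eq_zero.2 (eq_of_forall_exists_int hg hint (S x₀) x₀))

end Supercyclicity

theorem theorem1p3 {X : Type*} [AddCommGroup X] [Module ℂ X] [TopologicalSpace X]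
    [IsTopologicalAddGroup X] [ContinuousSMul ℂ X] [T2Space X]
    (hdim : ¬ FiniteDimensional ℂ X) (T : X →L[ℂ] X) :
    Supercyclicity.IsRPlusSupercyclic T ↔
      Supercyclicity.IsSupercyclic T ∧
        (Supercyclicity.dualPointSpectrum T = ∅ ∨
          ∃ (z : ℂ) (hz : z ≠ 0), Supercyclicity.dualPointSpectrum T = {z} ∧
            ¬ IsOfFinOrder (Supercyclicity.phase z hz)) := by
  constructor
  · intro hT
    have hsc : Supercyclicity.IsSupercyclic T := hT.isSupercyclic
    refine ⟨hsc, ?_⟩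
    obtain ⟨x, hx⟩ := hsc
    rcases (Supercyclicity.IsSupercyclicVector.dualPointSpectrum_subsingleton
      hx).eq_empty_or_singleton with h | ⟨z, h⟩
    · exact .inl h
    · obtain ⟨hz, hord⟩ := hT.ne_zero_and_not_isOfFinOrder (h ▸ Set.mem_singleton z)
      exact .inr ⟨z, hz, h, hord⟩
  · rintro ⟨hT, h | ⟨z, hz, h, hord⟩⟩
    · exact Supercyclicity.isRPlusSupercyclic_of_dualPointSpectrum_eq_empty hT h
    · exact Supercyclicity.isRPlusSupercyclic_of_dualPointSpectrum_eq_singleton hT hz h hord
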